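/- Let $N\in\mathbb N$, $D\ge 2$, and let $\mu,\nu$ be probability measures on $\mathbb R^D$ that are absolutely continuous with respect to Lebesgue measure. Let $X_1,\dots,X_N$ be i.i.d. with law $\mu$ and $Y_1,\dots,Y_N$ be i.i.d. with law $\nu$, the two collections being independent of each other. Let $p,q>0$ be real numbers, not both equal to $1$, and let $$c(x,y)=\|x-y\|_q^p=\Bigl(\sum_{i=1}^D|x_i-y_i|^q\Bigr)^{p/q},\qquad c_{ij}=c(X_i,Y_j).$$ Then, almost surely, the dual summability condition holds: for every $n\ge 2$ and all indices $i_1,\dots,i_n\in\{1,\dots,N\}$ pairwise different and $j_1,\dots,j_n\in\{1,\dots,N\}$ pairwise different, $$\sum_{k=1}^n c_{i_kj_k}\neq\sum_{k=1}^n c_{i_kj_{k-1}},\qquad j_0:=j_n.$$ In particular, with probability one, simultaneously for all $r,s\in\Delta_N=\{r\in\mathbb R^N: r_i\ge 0,\ \sum_i r_i=1\}$, the optimal transport coupling between $r(\mathbf X)=\sum_k r_k\delta_{X_k}$ and $s(\mathbf Y)=\sum_k s_k\delta_{Y_k}$ for the cost $c$ exists and is unique. That is, there is exactly one minimiser of $\sum_{i,j}c_{ij}\pi_{ij}$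 over all matrices $\pi\in\mathbb R^{N\times N}$ with $\pi_{ij}\ge 0$, $\sum_j\pi_{ij}=r_i$ and $\sum_i\pi_{ij}=s_j$; and, equivalently in terms of measures, there is exactly one minimiser of $\int c\,d\gamma$ over all measures $\gamma$ on $\mathbb R^D\times\mathbb R^D$ with marginals $r(\mathbf X)$ and $s(\mathbf Y)$. -/

import Mathlib

open MeasureTheory ProbabilityTheory
open scoped ENNReal

/-- The cost `c(x, y) = ‖x - y‖_q ^ p = (∑ i, |x i - y i| ^ q) ^ (p / q)` on `ℝ^D`. -/
noncomputable def lqCost {D : ℕ} (p q : ℝ) (x y : Fin D → ℝ) : ℝ :=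
  (∑ i, |x i - y i| ^ q) ^ (p / q)

/-- Dual summability of a cost matrix: for every `n ≥ 2` and every family of index pairs
`(i_k, j_k)`, `1 ≤ k ≤ n`, with pairwise different `i_k` and pairwise different `j_k`, one has
`∑ k, c (i_k) (j_k) ≠ ∑ k, c (i_k) (j_{k-1})`, where `j_0 = j_n`. The inverse of `finRotate n` is
the cyclic predecessor on `Fin n`. -/
def DualSummable {N : ℕ} (c : Fin N → Fin N → ℝ) : Prop :=
  ∀ n : ℕ, 2 ≤ n → ∀ i j : Fin n → Fin N, Function.Injective i → Function.Injective j →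
    ∑ k, c (i k) (j k) ≠ ∑ k, c (i k) (j ((finRotate n).symm k))

/-- `π ∈ Π(r, s)`: a nonnegative matrix with row sums `r` and column sums `s`. -/
def IsCouplingMatrix {N : ℕ} (r s : Fin N → ℝ) (π : Fin N → Fin N → ℝ) : Prop :=
  (∀ i, ∑ j, π i j = r i) ∧ (∀ j, ∑ i, π i j = s j) ∧ ∀ i j, 0 ≤ π i j

/-- `π` is an optimal transport coupling of `r` and `s` for the cost matrix `c`: it minimises
`∑ i j, c i j * π i j` over `Π(r, s)`. -/
def IsOptimalCouplingMatrix {N : ℕ} (c : Fin N → Fin N → ℝ) (r s : Fin N → ℝ)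
    (π : Fin N → Fin N → ℝ) : Prop :=
  IsCouplingMatrix r s π ∧ ∀ π', IsCouplingMatrix r s π' →
    ∑ i, ∑ j, c i j * π i j ≤ ∑ i, ∑ j, c i j * π' i j

/-- The measure `r(x) = ∑ k, r_k δ_{x_k}`. -/
noncomputable def weightedDirac {N D : ℕ} (r : Fin N → ℝ) (x : Fin N → Fin D → ℝ) :
    Measure (Fin D → ℝ) :=
  ∑ k, ENNReal.ofReal (r k) • Measure.dirac (x k)

/-- `γ` is an optimal coupling of the measures `m₁`, `m₂` on `ℝ^D` for the nonnegative cost `c`: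
it has marginals `m₁` and `m₂` and minimises the integrated cost among all such measures. -/
def IsOptimalCouplingMeasure {D : ℕ} (c : (Fin D → ℝ) → (Fin D → ℝ) → ℝ)
    (m₁ m₂ : Measure (Fin D → ℝ)) (γ : Measure ((Fin D → ℝ) × (Fin D → ℝ))) : Prop :=
  (γ.fst = m₁ ∧ γ.snd = m₂) ∧
    ∀ γ' : Measure ((Fin D → ℝ) × (Fin D → ℝ)), γ'.fst = m₁ ∧ γ'.snd = m₂ →
      ∫⁻ z, ENNReal.ofReal (c z.1 z.2) ∂γ ≤ ∫⁻ z, ENNReal.ofReal (c z.1 z.2) ∂γ'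

/-! Each forbidden equality says that a continuous function of the `2N` points, a difference of two
total costs, vanishes; there are countably many of them. Such a zero set is null once almost every
point has a nonzero line derivative in one of countably many directions
(`Continuous.ae_ne_zero_of_hasLineDerivAt`). When a single source point `x` moves, only one
difference `c(x,a) - c(x,b)` varies, so it suffices that the gradients of `c(·,a)` and `c(·,b)`
differ at generic points (`LqGeneric.exists_partial_ne`). Absolute continuity carries this over to
the samples.

The rest is deterministic. Two distinct optimal matrices differ by a matrix with zero row and column
sums, which contains an alternating cycle (`exists_alternating_cycle`). Rerouting mass along it in
both directions forces the two costs of the cycle to be equal, against dual summability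
(`DualSummable.optimal_unique`). Existence is compactness, and `exists_eq_matrixMeasure` identifies
coupling measures with coupling matrices. -/

/-! ### Null zero sets from nonvanishing line derivatives -/

/-- The zeros of a function on `ℝ` at which it has a nonzero derivative form a countable set. -/
theorem countable_zeros_hasDerivAt_ne_zero (f : ℝ → ℝ) :
    {t | f t = 0 ∧ ∃ d, d ≠ 0 ∧ HasDerivAt f d t}.Countable := by
  set T := {t | f t = 0 ∧ ∃ d, d ≠ 0 ∧ HasDerivAt f d t} with hT
  -- A nonzero derivative isolates each point of `T` within `T`, and a subset of `ℝ` has only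
  -- countably many points isolated from the right.
  refine Set.Countable.mono ?_ (countable_setOfPred_isolated_right_within (s := T))
  intro t ht
  refine ⟨ht, ?_⟩
  obtain ⟨-, d, hd, hder⟩ := ht
  have h1 : ∀ᶠ z in nhdsWithin t (T ∩ Set.Ioi t), f z ≠ 0 :=
    (hder.eventually_ne hd).filter_mono
      (nhdsWithin_mono _ fun z hz => ne_of_gt hz.2)
  have h2 : ∀ᶠ z in nhdsWithin t (T ∩ Set.Ioi t), z ∈ T ∩ Set.Ioi t := self_mem_nhdsWithin
  rw [← Filter.empty_mem_iff_bot]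
  filter_upwards [h1, h2] with z hz hz'
  exact hz hz'.1.1

/-- For almost every zero of a continuous function, the line derivative in a given direction
vanishes if it exists. -/
theorem Continuous.ae_hasLineDerivAt_eq_zero_of_eq_zero {E : Type*} [NormedAddCommGroup E]
    [NormedSpace ℝ E] [FiniteDimensional ℝ E] [MeasurableSpace E] [BorelSpace E]
    (μ : Measure E) [μ.IsAddHaarMeasure] {f : E → ℝ} (hf : Continuous f) (v : E) :
    ∀ᵐ x ∂μ, f x = 0 → ∀ d, HasLineDerivAt ℝ f d x v → d = 0 := by
  have hmeas : MeasurableSet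
      {x | ¬ (f x = 0 ∧ LineDifferentiableAt ℝ f x v ∧ lineDeriv ℝ f x v ≠ 0)} := by
    refine MeasurableSet.compl ?_
    refine (hf.measurable (measurableSet_singleton 0)).inter ?_
    exact (measurableSet_lineDifferentiableAt hf).inter
      (measurable_lineDeriv hf (measurableSet_singleton 0).compl)
  -- Fubini along the lines parallel to `v`: on each line the exceptional set is countable, hence
  -- null.
  have hae := ae_mem_of_ae_add_linearMap_mem
    ((LinearMap.id : ℝ →ₗ[ℝ] ℝ).smulRight v) (volume : Measure ℝ) μ hmeas (fun y => by
      have hc := (countable_zeros_hasDerivAt_ne_zero (fun t : ℝ => f (y + t • v))).ae_notMem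
        (volume : Measure ℝ)
      filter_upwards [hc] with t ht h
      obtain ⟨h0, h1, h2⟩ := h
      refine ht ⟨by simpa using h0, _, h2, ?_⟩
      have h3 : HasDerivAt (fun s : ℝ => f ((y + t • v) + s • v))
          (lineDeriv ℝ f (y + t • v) v) (t - t) := by
        simpa [HasLineDerivAt] using h1.hasLineDerivAt
      have h4 := h3.comp_sub_const t t
      refine h4.congr_of_eventuallyEq (Filter.Eventually.of_forall fun s => ?_)
      simp only [add_assoc, ← add_smul]
      congr 3
      ring)
  filter_upwards [hae] with x hx h0 d hd
  by_contra hne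
  exact hx ⟨h0, hd.lineDifferentiableAt, by rwa [hd.lineDeriv]⟩

/-- A continuous function vanishes only on a null set if at almost every point it has a nonzero
line derivative in one of countably many directions. -/
theorem Continuous.ae_ne_zero_of_hasLineDerivAt {E ι : Type*} [NormedAddCommGroup E]
    [NormedSpace ℝ E] [FiniteDimensional ℝ E] [MeasurableSpace E] [BorelSpace E] [Countable ι]
    (μ : Measure E) [μ.IsAddHaarMeasure] {f : E → ℝ} (hf : Continuous f) (v : ι → E)
    (h : ∀ᵐ x ∂μ, ∃ i, ∃ d, d ≠ 0 ∧ HasLineDerivAt ℝ f d x (v i)) :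
    ∀ᵐ x ∂μ, f x ≠ 0 := by
  filter_upwards [h, ae_all_iff.2 fun i => hf.ae_hasLineDerivAt_eq_zero_of_eq_zero μ (v i)]
    with x ⟨i, d, hd, hder⟩ hx h0
  exact hd (hx i h0 d hder)

theorem MeasureTheory.Measure.AbsolutelyContinuous.pi_fin {n : ℕ} {α : Fin n → Type*}
    [∀ i, MeasurableSpace (α i)] {μ ν : ∀ i, Measure (α i)} [∀ i, SigmaFinite (μ i)]
    [∀ i, SigmaFinite (ν i)] (h : ∀ i, μ i ≪ ν i) : Measure.pi μ ≪ Measure.pi ν := by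
  induction n with
  | zero => rw [Measure.pi_of_empty μ, Measure.pi_of_empty ν]
  | succ n ih =>
    have h1 := (measurePreserving_piFinSuccAbove μ 0).symm
    have h2 := (measurePreserving_piFinSuccAbove ν 0).symm
    rw [← h1.map_eq, ← h2.map_eq]
    exact (Measure.AbsolutelyContinuous.prod (h 0) (ih fun i => h _)).map h1.measurable

/-! ### The cost, its partial derivatives and when two gradients differ -/

theorem continuous_lqCost {D : ℕ} {p q : ℝ} (hp : 0 < p) (hq : 0 < q) :
    Continuous fun z : (Fin D → ℝ) × (Fin D → ℝ) => lqCost p q z.1 z.2 := by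
  unfold lqCost
  refine Continuous.rpow_const ?_ fun _ => Or.inr (by positivity)
  refine continuous_finsetSum _ fun i _ => Continuous.rpow_const ?_ fun _ => Or.inr hq.le
  fun_prop

theorem lqCost_nonneg {D : ℕ} (p q : ℝ) (x y : Fin D → ℝ) : 0 ≤ lqCost p q x y := by
  unfold lqCost
  positivity

/-- The partial derivative of `x ↦ lqCost p q x a` in the coordinate `m`, at a point at which
`x m ≠ a m`. -/
noncomputable def lqCostPartial {D : ℕ} (p q : ℝ) (m : Fin D) (x a : Fin D → ℝ) : ℝ :=
  (|x m - a m| ^ (q - 1) * SignType.sign (x m - a m) * q) * (p / q) *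
    (∑ i, |x i - a i| ^ q) ^ (p / q - 1)

theorem sum_abs_sub_rpow_pos {D : ℕ} (q : ℝ) (m : Fin D) {x a : Fin D → ℝ} (h : x m ≠ a m) :
    0 < ∑ i, |x i - a i| ^ q :=
  Finset.sum_pos' (fun i _ => by positivity)
    ⟨m, Finset.mem_univ _, Real.rpow_pos_of_pos (abs_pos.2 (sub_ne_zero.2 h)) _⟩

theorem hasDerivAt_abs_add_rpow {u : ℝ} (hu : u ≠ 0) (q : ℝ) :
    HasDerivAt (fun t : ℝ => |u + t| ^ q) (|u| ^ (q - 1) * SignType.sign u * q) 0 := by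
  have h1 : HasDerivAt (fun t : ℝ => u + t) 1 0 := (hasDerivAt_id 0).const_add u
  have h2 : HasDerivAt (fun t : ℝ => |u + t|) (SignType.sign u * 1 : ℝ) 0 := by
    have := (hasDerivAt_abs (x := u + 0) (by simpa using hu)).comp 0 h1
    simpa [Function.comp_def] using this
  have h3 := h2.rpow_const (p := q) (Or.inl (by simpa using hu))
  simp only [add_zero] at h3
  convert h3 using 1
  ring

/-- The condition `x m ≠ a m` acts twice: it makes the `m`-th summand differentiable, and it keeps
the sum positive, so that the outer power is differentiable too. -/
theorem hasDerivAt_lqCost {D : ℕ} (p q : ℝ) (m : Fin D) {x a : Fin D → ℝ} (h : x m ≠ a m) :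
    HasDerivAt (fun t : ℝ => lqCost p q (x + t • Pi.single m 1) a) (lqCostPartial p q m x a) 0 := by
  unfold lqCost lqCostPartial
  have h1 : HasDerivAt (fun t : ℝ => ∑ i, |(x + t • (Pi.single m 1 : Fin D → ℝ)) i - a i| ^ q)
      (∑ i, if i = m then |x m - a m| ^ (q - 1) * SignType.sign (x m - a m) * q else 0) 0 := by
    refine HasDerivAt.fun_sum fun i _ => ?_
    split_ifs with him
    · subst him
      refine (hasDerivAt_abs_add_rpow (sub_ne_zero.2 h) q).congr_of_eventuallyEq
        (Filter.Eventually.of_forall fun t => ?_)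
      simp [add_sub_right_comm]
    · simpa [him] using hasDerivAt_const (0 : ℝ) (|x i - a i| ^ q)
  simp only [Finset.sum_ite_eq', Finset.mem_univ, if_true] at h1
  have h2 := h1.rpow_const (p := p / q) (Or.inl (by
    simpa using (sum_abs_sub_rpow_pos q m h).ne'))
  simpa using h2

/-- A family of conditions on `x, a, b`, satisfied almost everywhere, under which the gradients of
`lqCost p q · a` and `lqCost p q · b` at `x` differ. -/
structure LqGeneric {D : ℕ} (x a b : Fin D → ℝ) : Prop where
  ne_left : ∀ m, x m ≠ a m
  ne_right : ∀ m, x m ≠ b m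
  sign_sum_ne : ∀ ε : Fin D → SignType, (∀ m, ε m ≠ 0) → ∑ m, (ε m : ℝ) * (a m - b m) ≠ 0
  cross_ne : ∃ m m', (x m - a m) * (x m' - b m') - (x m' - a m') * (x m - b m) ≠ 0

/-- If all partials agree, comparing signs and moduli shows that `x - a` and `x - b` have the same
signs and that `A|x_m - a_m|^(q-1) = B|x_m - b_m|^(q-1)` for all `m`. For `q ≠ 1`, taking roots
makes `x - a` and `x - b` parallel, against `cross_ne`. For `q = 1` it says `A = B`; as `p ≠ 1`, the
two `ℓ¹` distances agree, which with equal signs is a linear relation excluded by `sign_sum_ne`. -/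
theorem LqGeneric.exists_partial_ne {D : ℕ} {p q : ℝ} (hp : 0 < p) (hq : 0 < q)
    (hpq : ¬ (p = 1 ∧ q = 1)) {x a b : Fin D → ℝ} (h : LqGeneric x a b) :
    ∃ m, lqCostPartial p q m x a - lqCostPartial p q m x b ≠ 0 := by
  by_contra! hall
  obtain ⟨m₁, m₂, hcross⟩ := h.cross_ne
  have hSa := sum_abs_sub_rpow_pos q m₁ (h.ne_left m₁)
  have hSb := sum_abs_sub_rpow_pos q m₁ (h.ne_right m₁)
  set A := (∑ i, |x i - a i| ^ q) ^ (p / q - 1) with hA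
  set B := (∑ i, |x i - b i| ^ q) ^ (p / q - 1) with hB
  have hApos : 0 < A := Real.rpow_pos_of_pos hSa _
  have hBpos : 0 < B := Real.rpow_pos_of_pos hSb _
  have key : ∀ m, A * |x m - a m| ^ (q - 1) * SignType.sign (x m - a m) =
      B * |x m - b m| ^ (q - 1) * SignType.sign (x m - b m) := by
    intro m
    have := hall m
    simp only [lqCostPartial, ← hA, ← hB] at this
    have hqq : q * (p / q) ≠ 0 := by positivity
    apply mul_left_cancel₀ hqq
    linear_combination this
  have hcoef : ∀ {C u : ℝ}, 0 < C → u ≠ 0 → 0 < C * |u| ^ (q - 1) := fun hC hu =>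
    mul_pos hC (Real.rpow_pos_of_pos (abs_pos.2 hu) _)
  have hua : ∀ m, x m - a m ≠ 0 := fun m => sub_ne_zero.2 (h.ne_left m)
  have hub : ∀ m, x m - b m ≠ 0 := fun m => sub_ne_zero.2 (h.ne_right m)
  have hsign : ∀ m, SignType.sign (x m - a m) = SignType.sign (x m - b m) := by
    intro m
    have h1 := key m
    have ca := hcoef hApos (hua m)
    have cb := hcoef hBpos (hub m)
    rcases lt_or_gt_of_ne (hua m) with ha | ha <;> rcases lt_or_gt_of_ne (hub m) with hb | hb <;>
      simp only [sign_neg, sign_pos, ha, hb, SignType.coe_one, SignType.coe_neg_one] at h1 ⊢ <;>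
      linarith
  have habs : ∀ m, A * |x m - a m| ^ (q - 1) = B * |x m - b m| ^ (q - 1) := by
    intro m
    have h1 := key m
    rw [← hsign m] at h1
    refine mul_right_cancel₀ ?_ h1
    rcases lt_or_gt_of_ne (hua m) with ha | ha <;> simp [sign_neg, sign_pos, ha]
  by_cases hq1 : q = 1
  · subst hq1
    have hp1 : p - 1 ≠ 0 := fun h0 => hpq ⟨by linarith, rfl⟩
    have hAB : A = B := by simpa using habs m₁
    simp only [Real.rpow_one, div_one] at hA hB hSa hSb
    have hS : ∑ i, |x i - a i| = ∑ i, |x i - b i| :=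
      (Real.rpow_left_inj hSa.le hSb.le hp1).1 (by rw [← hA, ← hB, hAB])
    refine h.sign_sum_ne (fun m => SignType.sign (x m - a m)) (fun m => ?_) ?_
    · simpa [sign_eq_zero_iff] using hua m
    · have h2 : ∀ m, ((SignType.sign (x m - a m) : SignType) : ℝ) * (a m - b m) =
          |x m - b m| - |x m - a m| := by
        intro m
        rw [← sign_mul_self (x m - b m), ← sign_mul_self (x m - a m), ← hsign m]
        ring
      simp only [h2, Finset.sum_sub_distrib, hS, sub_self]
  · have hq1' : q - 1 ≠ 0 := sub_ne_zero.2 hq1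
    have hlam : ∀ m, |x m - a m| = (B / A) ^ (q - 1)⁻¹ * |x m - b m| := by
      intro m
      have h1 : |x m - a m| ^ (q - 1) = (B / A) * |x m - b m| ^ (q - 1) := by
        field_simp
        linarith [habs m]
      rw [← Real.rpow_left_inj (abs_nonneg _) (by positivity) hq1', h1,
        Real.mul_rpow (by positivity) (abs_nonneg _), ← Real.rpow_mul (by positivity),
        inv_mul_cancel₀ hq1', Real.rpow_one]
    set l := (B / A) ^ (q - 1)⁻¹
    have hlin : ∀ m, x m - a m = l * (x m - b m) := by
      intro m
      have ha := sign_mul_abs (x m - a m)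
      have hb := sign_mul_abs (x m - b m)
      rw [hlam m, hsign m] at ha
      linear_combination (-1 : ℝ) * ha + l * hb
    exact hcross (by rw [hlin m₁, hlin m₂]; ring)

/-! ### Generic configurations are dual summable -/

instance isAddHaarMeasure_volume_configurations (N D : ℕ) :
    (volume : Measure ((Fin N → Fin D → ℝ) × (Fin N → Fin D → ℝ))).IsAddHaarMeasure :=
  have : (volume : Measure (Fin D → ℝ)).IsAddHaarMeasure := isAddHaarMeasure_volume_pi _
  have : (volume : Measure (Fin N → Fin D → ℝ)).IsAddHaarMeasure :=
    Measure.pi.isAddHaarMeasure fun _ : Fin N => (volume : Measure (Fin D → ℝ))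
  Measure.prod.instIsAddHaarMeasure _ _

/-- Coordinate direction of the coordinate `m` of the `i`-th source point, in the space of all
pairs of configurations of `N` points in `ℝ^D`. -/
def sourceDir {N D : ℕ} (i : Fin N) (m : Fin D) : (Fin N → Fin D → ℝ) × (Fin N → Fin D → ℝ) :=
  (Pi.single i (Pi.single m 1), 0)

/-- Coordinate direction of the coordinate `m` of the `j`-th target point. -/
def targetDir {N D : ℕ} (j : Fin N) (m : Fin D) : (Fin N → Fin D → ℝ) × (Fin N → Fin D → ℝ) :=
  (0, Pi.single j (Pi.single m 1))

theorem ae_source_ne_target {N D : ℕ} (i j : Fin N) (m : Fin D) :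
    ∀ᵐ z : (Fin N → Fin D → ℝ) × (Fin N → Fin D → ℝ), z.1 i m ≠ z.2 j m := by
  have h := Continuous.ae_ne_zero_of_hasLineDerivAt (ι := Unit)
    (volume : Measure ((Fin N → Fin D → ℝ) × (Fin N → Fin D → ℝ)))
    (f := fun z => z.1 i m - z.2 j m) (by fun_prop) (fun _ => sourceDir i m)
    (Filter.Eventually.of_forall fun z => ⟨(), 1, one_ne_zero, by
      have : HasDerivAt (fun t : ℝ => z.1 i m + t - z.2 j m) 1 0 :=
        ((hasDerivAt_id (0 : ℝ)).const_add _).sub_const _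
      simpa [HasLineDerivAt, sourceDir] using this⟩)
  filter_upwards [h] with z hz h0
  exact hz (sub_eq_zero.2 h0)

theorem ae_target_sum_ne {N D : ℕ} {j j' : Fin N} (hj : j ≠ j') (w : Fin D → ℝ) {m : Fin D}
    (hw : w m ≠ 0) :
    ∀ᵐ z : (Fin N → Fin D → ℝ) × (Fin N → Fin D → ℝ),
      ∑ l, w l * (z.2 j l - z.2 j' l) ≠ 0 := by
  refine Continuous.ae_ne_zero_of_hasLineDerivAt (ι := Unit) volume
    (f := fun z : (Fin N → Fin D → ℝ) × (Fin N → Fin D → ℝ) =>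
      ∑ l, w l * (z.2 j l - z.2 j' l)) (by fun_prop) (fun _ => targetDir j m)
    (Filter.Eventually.of_forall fun z => ⟨(), w m, hw, ?_⟩)
  have h1 : HasDerivAt
      (fun t : ℝ => ∑ l, w l * (z.2 j l + t * (Pi.single m 1 : Fin D → ℝ) l - z.2 j' l))
      (∑ l, w l * (1 * (Pi.single m 1 : Fin D → ℝ) l)) 0 :=
    HasDerivAt.fun_sum fun l _ =>
      ((((hasDerivAt_id (0 : ℝ)).mul_const _).const_add _).sub_const _).const_mul _
  simpa [HasLineDerivAt, targetDir, hj.symm, Pi.single_apply] using h1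

theorem ae_cross_ne {N D : ℕ} (i : Fin N) {j j' : Fin N} (hj : j ≠ j') {m m' : Fin D}
    (hm : m ≠ m') :
    ∀ᵐ z : (Fin N → Fin D → ℝ) × (Fin N → Fin D → ℝ),
      (z.1 i m - z.2 j m) * (z.1 i m' - z.2 j' m') -
        (z.1 i m' - z.2 j m') * (z.1 i m - z.2 j' m) ≠ 0 := by
  refine Continuous.ae_ne_zero_of_hasLineDerivAt (ι := Unit) volume
    (f := fun z : (Fin N → Fin D → ℝ) × (Fin N → Fin D → ℝ) =>
      (z.1 i m - z.2 j m) * (z.1 i m' - z.2 j' m') -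
        (z.1 i m' - z.2 j m') * (z.1 i m - z.2 j' m)) (by fun_prop) (fun _ => sourceDir i m) ?_
  -- The determinant is affine in coordinate `m` of the source, with slope the difference of the two
  -- targets in coordinate `m'`.
  filter_upwards [ae_target_sum_ne hj (Pi.single m' 1) (m := m') (by simp)] with z hz
  refine ⟨(), z.2 j m' - z.2 j' m', by simpa [Pi.single_apply] using hz, ?_⟩
  have h1 : HasDerivAt (fun t : ℝ => (z.1 i m + t - z.2 j m) * (z.1 i m' - z.2 j' m') -
        (z.1 i m' - z.2 j m') * (z.1 i m + t - z.2 j' m))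
      (1 * (z.1 i m' - z.2 j' m') - (z.1 i m' - z.2 j m') * 1) 0 :=
    ((((hasDerivAt_id (0 : ℝ)).const_add _).sub_const _).mul_const _).sub
      ((((hasDerivAt_id (0 : ℝ)).const_add _).sub_const _).const_mul _)
  have h2 : 1 * (z.1 i m' - z.2 j' m') - (z.1 i m' - z.2 j m') * 1 = z.2 j m' - z.2 j' m' := by
    ring
  rw [h2] at h1
  simpa [HasLineDerivAt, sourceDir, hm.symm] using h1

theorem ae_lqGeneric {N D : ℕ} (hD : 2 ≤ D) (i : Fin N) {j j' : Fin N} (hj : j ≠ j') :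
    ∀ᵐ z : (Fin N → Fin D → ℝ) × (Fin N → Fin D → ℝ), LqGeneric (z.1 i) (z.2 j) (z.2 j') := by
  have h3 : ∀ᵐ z : (Fin N → Fin D → ℝ) × (Fin N → Fin D → ℝ),
      ∀ ε : Fin D → SignType, (∀ m, ε m ≠ 0) → ∑ m, (ε m : ℝ) * (z.2 j m - z.2 j' m) ≠ 0 := by
    refine ae_all_iff.2 fun ε => ?_
    by_cases hε : ∀ m, ε m ≠ 0
    · have h0 : ((ε ⟨0, by omega⟩ : SignType) : ℝ) ≠ 0 := by
        generalize_proofs h0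
        rcases SignType.trichotomy (ε ⟨0, h0⟩) with h | h | h
        · simp [h]
        · exact absurd h (hε _)
        · simp [h]
      filter_upwards [ae_target_sum_ne hj (fun m => (ε m : ℝ)) h0] with z hz _ using hz
    · exact Filter.Eventually.of_forall fun z h => absurd h hε
  -- Two distinct coordinates are needed: in dimension one the two difference vectors are always
  -- parallel.
  have hm : (⟨0, by omega⟩ : Fin D) ≠ ⟨1, by omega⟩ := by simp
  filter_upwards [ae_all_iff.2 fun m => ae_source_ne_target i j m,
    ae_all_iff.2 fun m => ae_source_ne_target i j' m, h3, ae_cross_ne i hj hm]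
    with z h1 h2 h3 h4
  exact ⟨h1, h2, h3, _, _, h4⟩

theorem hasLineDerivAt_lqCost_sourceDir {N D : ℕ} (p q : ℝ)
    {z : (Fin N → Fin D → ℝ) × (Fin N → Fin D → ℝ)} {i j : Fin N} {m : Fin D}
    (h : z.1 i m ≠ z.2 j m) :
    HasLineDerivAt ℝ (fun z : (Fin N → Fin D → ℝ) × (Fin N → Fin D → ℝ) =>
      lqCost p q (z.1 i) (z.2 j)) (lqCostPartial p q m (z.1 i) (z.2 j)) z (sourceDir i m) := by
  refine (hasDerivAt_lqCost p q m h).congr_of_eventuallyEq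
    (Filter.Eventually.of_forall fun t => ?_)
  simp [sourceDir]

theorem hasLineDerivAt_lqCost_sourceDir_of_ne {N D : ℕ} (p q : ℝ)
    (z : (Fin N → Fin D → ℝ) × (Fin N → Fin D → ℝ)) {i i' : Fin N} (j : Fin N) (m : Fin D)
    (h : i' ≠ i) :
    HasLineDerivAt ℝ (fun z : (Fin N → Fin D → ℝ) × (Fin N → Fin D → ℝ) =>
      lqCost p q (z.1 i') (z.2 j)) 0 z (sourceDir i m) := by
  refine (hasDerivAt_const (0 : ℝ) (lqCost p q (z.1 i') (z.2 j))).congr_of_eventuallyEq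
    (Filter.Eventually.of_forall fun t => ?_)
  simp [sourceDir, h]

/-- If `j` and `j'` differ at `k₀`, then the total costs of the assignments `(i, j)` and `(i, j')`
differ almost everywhere. -/
theorem ae_sum_lqCost_ne {N D n : ℕ} (hD : 2 ≤ D) {p q : ℝ} (hp : 0 < p) (hq : 0 < q)
    (hpq : ¬ (p = 1 ∧ q = 1)) {i j j' : Fin n → Fin N} (hi : Function.Injective i) (k₀ : Fin n)
    (hj : j k₀ ≠ j' k₀) :
    ∀ᵐ z : (Fin N → Fin D → ℝ) × (Fin N → Fin D → ℝ),
      ∑ k, lqCost p q (z.1 (i k)) (z.2 (j k)) ≠ ∑ k, lqCost p q (z.1 (i k)) (z.2 (j' k)) := by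
  have hcont : ∀ a b : Fin N, Continuous fun z : (Fin N → Fin D → ℝ) × (Fin N → Fin D → ℝ) =>
      lqCost p q (z.1 a) (z.2 b) := fun a b =>
    (continuous_lqCost hp hq).comp (f := fun z : (Fin N → Fin D → ℝ) × (Fin N → Fin D → ℝ) =>
      (z.1 a, z.2 b)) (by fun_prop)
  have h := Continuous.ae_ne_zero_of_hasLineDerivAt volume
    (f := fun z : (Fin N → Fin D → ℝ) × (Fin N → Fin D → ℝ) =>
      ∑ k, (lqCost p q (z.1 (i k)) (z.2 (j k)) - lqCost p q (z.1 (i k)) (z.2 (j' k))))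
    (continuous_finsetSum _ fun k _ => (hcont _ _).sub (hcont _ _))
    (fun m : Fin D => sourceDir (i k₀) m) (by
      filter_upwards [ae_lqGeneric hD (i k₀) hj] with z hz
      obtain ⟨m, hm⟩ := hz.exists_partial_ne hp hq hpq
      refine ⟨m, _, hm, ?_⟩
      -- Since `i` is injective, moving the source point `i k₀` leaves every summand with `k ≠ k₀`
      -- constant.
      have h1 : HasDerivAt (fun t : ℝ =>
          ∑ k, (lqCost p q ((z + t • sourceDir (i k₀) m).1 (i k))
              ((z + t • sourceDir (i k₀) m).2 (j k)) -
            lqCost p q ((z + t • sourceDir (i k₀) m).1 (i k))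
              ((z + t • sourceDir (i k₀) m).2 (j' k))))
          (∑ k, if k = k₀ then lqCostPartial p q m (z.1 (i k₀)) (z.2 (j k₀)) -
            lqCostPartial p q m (z.1 (i k₀)) (z.2 (j' k₀)) else 0) 0 := by
        refine HasDerivAt.fun_sum fun k _ => ?_
        split_ifs with hk
        · subst hk
          exact (hasLineDerivAt_lqCost_sourceDir p q (hz.ne_left m)).sub
            (hasLineDerivAt_lqCost_sourceDir p q (hz.ne_right m))
        · simpa [HasLineDerivAt, Pi.sub_def] using
            (hasLineDerivAt_lqCost_sourceDir_of_ne p q z (j k) m (hi.ne hk)).sub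
            (hasLineDerivAt_lqCost_sourceDir_of_ne p q z (j' k) m (hi.ne hk))
      simpa [HasLineDerivAt] using h1)
  filter_upwards [h] with z hz h0
  exact hz (by rw [Finset.sum_sub_distrib, h0, sub_self])

theorem ae_dualSummable_lqCost {N D : ℕ} (hD : 2 ≤ D) {p q : ℝ} (hp : 0 < p) (hq : 0 < q)
    (hpq : ¬ (p = 1 ∧ q = 1)) :
    ∀ᵐ z : (Fin N → Fin D → ℝ) × (Fin N → Fin D → ℝ),
      DualSummable fun i j => lqCost p q (z.1 i) (z.2 j) := by
  unfold DualSummable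
  refine ae_all_iff.2 fun n => ?_
  by_cases hn : 2 ≤ n
  swap
  · exact Filter.Eventually.of_forall fun z h => absurd h hn
  suffices h : ∀ᵐ z : (Fin N → Fin D → ℝ) × (Fin N → Fin D → ℝ), ∀ i j : Fin n → Fin N,
      Function.Injective i ∧ Function.Injective j →
        ∑ k, lqCost p q (z.1 (i k)) (z.2 (j k)) ≠
          ∑ k, lqCost p q (z.1 (i k)) (z.2 (j ((finRotate n).symm k))) by
    filter_upwards [h] with z hz _ i j hi hj using hz i j ⟨hi, hj⟩
  refine ae_all_iff.2 fun i => ae_all_iff.2 fun j => ?_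
  by_cases hij : Function.Injective i ∧ Function.Injective j
  swap
  · exact Filter.Eventually.of_forall fun z h => absurd h hij
  obtain ⟨hi, hj⟩ := hij
  suffices h : ∀ᵐ z : (Fin N → Fin D → ℝ) × (Fin N → Fin D → ℝ),
      ∑ k, lqCost p q (z.1 (i k)) (z.2 (j k)) ≠
        ∑ k, lqCost p q (z.1 (i k)) (z.2 (j ((finRotate n).symm k))) by
    filter_upwards [h] with z hz _ using hz
  obtain ⟨n, rfl⟩ := Nat.exists_eq_add_of_le' hn
  -- With at least two indices the rotation has no fixed point at `0`, so the two assignments differ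
  -- there.
  refine ae_sum_lqCost_ne hD hp hq hpq hi 0 (hj.ne fun h => ?_)
  rw [eq_comm, Equiv.symm_apply_eq, finRotate_apply_zero] at h
  simp at h

/-- The joint law of two independent samples from absolutely continuous laws is absolutely
continuous. -/
theorem map_samples_absolutelyContinuous {Ω : Type*} [MeasurableSpace Ω] {P : Measure Ω}
    [IsProbabilityMeasure P] {N D : ℕ} {μ ν : Measure (Fin D → ℝ)} [IsProbabilityMeasure μ]
    [IsProbabilityMeasure ν] (hμ : μ ≪ volume) (hν : ν ≪ volume) {X Y : Fin N → Ω → Fin D → ℝ}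
    (hXlaw : ∀ k, HasLaw (X k) μ P) (hYlaw : ∀ k, HasLaw (Y k) ν P)
    (hX : iIndepFun X P) (hY : iIndepFun Y P)
    (hXY : IndepFun (fun ω k => X k ω) (fun ω k => Y k ω) P) :
    AEMeasurable (fun ω => ((fun k => X k ω), fun k => Y k ω)) P ∧
      P.map (fun ω => ((fun k => X k ω), fun k => Y k ω)) ≪ volume := by
  have h := hXY.hasLaw_prod (hX.hasLaw_pi hXlaw) (hY.hasLaw_pi hYlaw)
  refine ⟨h.aemeasurable, ?_⟩
  rw [h.map_eq]
  exact (Measure.AbsolutelyContinuous.pi_fin fun _ => hμ).prod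
    (Measure.AbsolutelyContinuous.pi_fin fun _ => hν)

/-! ### Alternating cycles and uniqueness of the optimal matrix -/

theorem Function.exists_mem_periodicPts_of_finite {α : Type*} [Finite α] (f : α → α) (x : α) :
    ∃ y, y ∈ Function.periodicPts f := by
  obtain ⟨m, n, hne, h⟩ := Finite.exists_ne_map_eq_of_infinite fun k : ℕ => f^[k] x
  wlog hmn : m < n generalizing m n
  · exact this n m hne.symm h.symm (by omega)
  refine ⟨f^[m] x, n - m, by omega, ?_⟩
  rw [Function.IsPeriodicPt, Function.IsFixedPt, ← Function.iterate_add_apply,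
    Nat.sub_add_cancel hmn.le]
  exact h.symm

/-- A nonzero matrix with vanishing row and column sums has a cycle of alternating signs. -/
theorem exists_alternating_cycle {N : ℕ} {δ : Fin N → Fin N → ℝ} (hrow : ∀ i, ∑ j, δ i j = 0)
    (hcol : ∀ j, ∑ i, δ i j = 0) (hδ : δ ≠ 0) :
    ∃ n, 2 ≤ n ∧ ∃ i j : Fin n → Fin N, Function.Injective i ∧ Function.Injective j ∧
      (∀ k, 0 < δ (i k) (j k)) ∧ ∀ k, δ (i k) (j ((finRotate n).symm k)) < 0 := by
  -- A nonzero row has a positive entry and a nonzero column a negative one. Going from row to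
  -- column to row by such entries gives a self-map of the nonzero rows, and a periodic orbit of it
  -- is the cycle.
  have hpos : ∀ i : {i // ∃ j, δ i j ≠ 0}, ∃ j : {j // ∃ i, δ i j ≠ 0}, 0 < δ i j := by
    rintro ⟨i, j, hij⟩
    obtain ⟨j', -, hj'⟩ := Finset.exists_pos_of_sum_zero_of_exists_nonzero _ (hrow i)
      ⟨j, Finset.mem_univ _, hij⟩
    exact ⟨⟨j', i, hj'.ne'⟩, hj'⟩
  have hneg : ∀ j : {j // ∃ i, δ i j ≠ 0}, ∃ i : {i // ∃ j, δ i j ≠ 0}, δ i j < 0 := by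
    rintro ⟨j, i, hij⟩
    obtain ⟨i', -, hi'⟩ := Finset.exists_pos_of_sum_zero_of_exists_nonzero
      (s := Finset.univ) (fun i' => - δ i' j) (by simp [hcol])
      ⟨i, Finset.mem_univ _, neg_ne_zero.2 hij⟩
    exact ⟨⟨i', j, by linarith⟩, by linarith⟩
  choose f hf using hpos
  choose g hg using hneg
  set h := fun i => g (f i) with h_def
  obtain ⟨i₀, j₀, hij₀⟩ : ∃ i j, δ i j ≠ 0 := by
    by_contra! hall
    exact hδ (funext fun i => funext fun j => hall i j)
  obtain ⟨y, hy⟩ := Function.exists_mem_periodicPts_of_finite h ⟨i₀, j₀, hij₀⟩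
  have hn0 := Function.minimalPeriod_pos_of_mem_periodicPts hy
  have hper : h^[Function.minimalPeriod h y] y = y := Function.iterate_minimalPeriod
  have hinj := Function.iterate_injOn_Iio_minimalPeriod (f := h) (x := y)
  -- A fixed row would make one entry both positive and negative.
  have hn1 : Function.minimalPeriod h y ≠ 1 := by
    intro h1
    rw [h1] at hper
    have h2 := hg (f y)
    rw [show g (f y) = y from hper] at h2
    exact lt_asymm h2 (hf y)
  obtain ⟨n, hn⟩ := Nat.exists_eq_add_of_le' (show 2 ≤ Function.minimalPeriod h y by omega)
  rw [hn] at hper hinj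
  have hi : Function.Injective fun k : Fin (n + 2) => h^[k] y := fun k l hkl =>
    Fin.ext (hinj k.2 l.2 hkl)
  have hstep : ∀ k : Fin (n + 2), h^[(finRotate (n + 2) k : Fin (n + 2))] y = h (h^[k] y) := by
    intro k
    rw [← Function.iterate_succ_apply' h, coe_finRotate]
    split_ifs with hk
    · rw [hk, Fin.val_last, Function.iterate_zero, id, Nat.succ_eq_add_one, hper]
    · rfl
  refine ⟨n + 2, by omega, fun k => h^[k] y, fun k => f (h^[k] y),
    Subtype.val_injective.comp hi, fun k l hkl => ?_, fun k => hf _, fun k => ?_⟩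
  -- Equal columns lead to equal successor rows, and rows within one minimal period are distinct.
  · have h1 : h (h^[k] y) = h (h^[l] y) := congrArg g (Subtype.val_injective hkl)
    rw [← hstep, ← hstep] at h1
    exact (finRotate (n + 2)).injective (hi h1)
  · have h1 := hstep ((finRotate (n + 2)).symm k)
    rw [Equiv.apply_symm_apply] at h1
    simp only [h1]
    exact hg _

theorem exists_pos_smul_le {ι : Type*} [Finite ι] {π A : ι → ℝ} (hπ : ∀ a, 0 ≤ π a)
    (hA : ∀ a, 0 < A a → 0 < π a) : ∃ ε > 0, ∀ a, ε * A a ≤ π a := by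
  have h : ∀ᶠ ε in nhdsWithin (0 : ℝ) (Set.Ioi 0), ∀ a, ε * A a ≤ π a := by
    refine Filter.eventually_all.2 fun a => ?_
    rcases le_or_gt (A a) 0 with ha | ha
    · filter_upwards [self_mem_nhdsWithin] with ε hε
      exact (mul_nonpos_of_nonneg_of_nonpos (le_of_lt hε) ha).trans (hπ a)
    · have ht : Filter.Tendsto (fun ε : ℝ => ε * A a) (nhdsWithin 0 (Set.Ioi 0)) (nhds 0) := by
        have : Filter.Tendsto (fun ε : ℝ => ε * A a) (nhds 0) (nhds (0 * A a)) :=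
          (continuous_id.mul continuous_const).tendsto 0
        rw [zero_mul] at this
        exact this.mono_left nhdsWithin_le_nhds
      exact (ht.eventually_lt_const (hA a ha)).mono fun _ => le_of_lt
  obtain ⟨ε, h1, h2⟩ := (h.and self_mem_nhdsWithin).exists
  exact ⟨ε, h2, h1⟩

/-- First order optimality: no admissible direction decreases the cost. -/
theorem IsOptimalCouplingMatrix.sum_mul_nonpos {N : ℕ} {c : Fin N → Fin N → ℝ} {r s : Fin N → ℝ}
    {π A : Fin N → Fin N → ℝ} (h : IsOptimalCouplingMatrix c r s π) (hrow : ∀ i, ∑ j, A i j = 0)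
    (hcol : ∀ j, ∑ i, A i j = 0) (hA : ∀ i j, 0 < A i j → 0 < π i j) :
    ∑ i, ∑ j, c i j * A i j ≤ 0 := by
  obtain ⟨⟨h1, h2, h3⟩, hopt⟩ := h
  obtain ⟨ε, hε, hle⟩ := exists_pos_smul_le (π := fun a : Fin N × Fin N => π a.1 a.2)
    (A := fun a => A a.1 a.2) (fun a => h3 _ _) (fun a => hA _ _)
  -- The perturbation is `-A`: mass is removed where `A` is positive, which is why `π` must be
  -- positive there.
  have := hopt (fun i j => π i j - ε * A i j) ⟨fun i => by
      rw [Finset.sum_sub_distrib, ← Finset.mul_sum, hrow, h1, mul_zero, sub_zero],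
    fun j => by rw [Finset.sum_sub_distrib, ← Finset.mul_sum, hcol, h2, mul_zero, sub_zero],
    fun i j => sub_nonneg.2 (hle (i, j))⟩
  have h4 : ∑ i, ∑ j, c i j * (π i j - ε * A i j) =
      ∑ i, ∑ j, c i j * π i j - ε * ∑ i, ∑ j, c i j * A i j := by
    simp only [Finset.mul_sum, ← Finset.sum_sub_distrib]
    exact Finset.sum_congr rfl fun i _ => Finset.sum_congr rfl fun j _ => by ring
  rw [h4] at this
  by_contra! hpos
  nlinarith [mul_pos hε hpos]

/-- Signed incidence matrix of the cycle through the cells `(i k, j k)` and `(i k, j' k)`. -/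
def cycleMatrix {N n : ℕ} (i j j' : Fin n → Fin N) (a b : Fin N) : ℝ :=
  ∑ k, ((if i k = a ∧ j k = b then 1 else 0) - if i k = a ∧ j' k = b then 1 else 0)

theorem sum_mul_cycleMatrix {N n : ℕ} (c : Fin N → Fin N → ℝ) (i j j' : Fin n → Fin N) :
    ∑ a, ∑ b, c a b * cycleMatrix i j j' a b = ∑ k, c (i k) (j k) - ∑ k, c (i k) (j' k) := by
  have hsingle : ∀ j : Fin n → Fin N,
      ∑ k, ∑ a, ∑ b, c a b * (if i k = a ∧ j k = b then (1 : ℝ) else 0) =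
        ∑ k, c (i k) (j k) := by
    intro j
    refine Finset.sum_congr rfl fun k _ => ?_
    simp [ite_and]
  have hswap : ∀ g : Fin n → Fin N → Fin N → ℝ,
      ∑ a, ∑ b, ∑ k, g k a b = ∑ k, ∑ a, ∑ b, g k a b := by
    intro g
    rw [Finset.sum_comm (s := Finset.univ (α := Fin n))]
    exact Finset.sum_congr rfl fun a _ => Finset.sum_comm
  simp only [cycleMatrix, Finset.sum_sub_distrib, mul_sub, Finset.mul_sum]
  rw [hswap, hswap, hsingle, hsingle]

theorem cycleMatrix_row_sum {N n : ℕ} (i j j' : Fin n → Fin N) (a : Fin N) :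
    ∑ b, cycleMatrix i j j' a b = 0 := by
  simp only [cycleMatrix]
  rw [Finset.sum_comm]
  exact Finset.sum_eq_zero fun k _ => by simp [ite_and]

/-- Row sums cancel term by term; column sums cancel only in total, because the second column family
is a rearrangement of the first. -/
theorem cycleMatrix_col_sum {N n : ℕ} (i j : Fin n → Fin N) (e : Equiv.Perm (Fin n)) (b : Fin N) :
    ∑ a, cycleMatrix i j (fun k => j (e k)) a b = 0 := by
  simp only [cycleMatrix]
  rw [Finset.sum_comm]
  simp only [Finset.sum_sub_distrib, ite_and, Finset.sum_ite_eq, Finset.mem_univ, if_true]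
  rw [Equiv.sum_comp e fun k => if j k = b then (1 : ℝ) else 0, sub_self]

theorem exists_of_cycleMatrix_pos {N n : ℕ} {i j j' : Fin n → Fin N} {a b : Fin N}
    (h : 0 < cycleMatrix i j j' a b) : ∃ k, i k = a ∧ j k = b := by
  by_contra! hall
  refine absurd h (not_lt.2 (Finset.sum_nonpos fun k _ => ?_))
  rw [if_neg fun hk => hall k hk.1 hk.2]
  split_ifs <;> norm_num

theorem cycleMatrix_swap {N n : ℕ} (i j j' : Fin n → Fin N) (a b : Fin N) :
    cycleMatrix i j' j a b = - cycleMatrix i j j' a b := by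
  simp [cycleMatrix]

/-- On the cycle of `π - π'`, `π` is positive on the positive cells and `π'` on the negative ones.
Each plan can thus be rerouted along the cycle, in opposite directions, and optimality of both gives
opposite inequalities between the two cycle costs. -/
theorem DualSummable.optimal_unique {N : ℕ} {c : Fin N → Fin N → ℝ} (hc : DualSummable c)
    {r s : Fin N → ℝ} {π π' : Fin N → Fin N → ℝ} (h : IsOptimalCouplingMatrix c r s π)
    (h' : IsOptimalCouplingMatrix c r s π') : π = π' := by
  by_contra hne
  obtain ⟨n, hn, i, j, hi, hj, hpos, hneg⟩ := exists_alternating_cycle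
    (δ := fun a b => π a b - π' a b)
    (fun a => by rw [Finset.sum_sub_distrib, h.1.1, h'.1.1, sub_self])
    (fun b => by rw [Finset.sum_sub_distrib, h.1.2.1, h'.1.2.1, sub_self])
    (fun h0 => hne (funext fun a => funext fun b => sub_eq_zero.1 (congrFun (congrFun h0 a) b)))
  set j' := fun k => j ((finRotate n).symm k) with hj'
  have hrow := cycleMatrix_row_sum i j j'
  have hcol : ∀ b, ∑ a, cycleMatrix i j j' a b = 0 := cycleMatrix_col_sum i j (finRotate n).symm
  have h1 := h.sum_mul_nonpos hrow hcol fun a b hab => by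
    obtain ⟨k, rfl, rfl⟩ := exists_of_cycleMatrix_pos hab
    linarith [hpos k, h'.1.2.2 (i k) (j k)]
  have h2 := h'.sum_mul_nonpos (A := cycleMatrix i j' j)
    (fun a => by simp only [cycleMatrix_swap i j j', Finset.sum_neg_distrib, hrow, neg_zero])
    (fun b => by simp only [cycleMatrix_swap i j j', Finset.sum_neg_distrib, hcol, neg_zero])
    fun a b hab => by
      obtain ⟨k, rfl, rfl⟩ := exists_of_cycleMatrix_pos hab
      linarith [hneg k, h.1.2.2 (i k) (j' k)]
  rw [sum_mul_cycleMatrix] at h1 h2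
  exact hc n hn i j hi hj (by linarith)

theorem exists_isOptimalCouplingMatrix {N : ℕ} (c : Fin N → Fin N → ℝ) {r s : Fin N → ℝ}
    (hr : r ∈ stdSimplex ℝ (Fin N)) (hs : s ∈ stdSimplex ℝ (Fin N)) :
    ∃ π, IsOptimalCouplingMatrix c r s π := by
  have hclosed : IsClosed {π : Fin N → Fin N → ℝ | IsCouplingMatrix r s π} := by
    simp only [IsCouplingMatrix, Set.ofPred_and, Set.ofPred_forall]
    refine (isClosed_iInter fun i => isClosed_eq (by fun_prop) continuous_const).inter
      ((isClosed_iInter fun j => isClosed_eq (by fun_prop) continuous_const).inter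
        (isClosed_iInter fun i => isClosed_iInter fun j =>
          isClosed_le continuous_const (by fun_prop)))
  have hsub : {π : Fin N → Fin N → ℝ | IsCouplingMatrix r s π} ⊆
      Set.Icc 0 fun _ _ => 1 := by
    intro π hπ
    refine ⟨fun i j => hπ.2.2 i j, fun i j => ?_⟩
    calc π i j ≤ ∑ j, π i j :=
          Finset.single_le_sum (f := π i) (fun j _ => hπ.2.2 i j) (Finset.mem_univ j)
      _ = r i := hπ.1 i
      _ ≤ ∑ i, r i := Finset.single_le_sum (fun i _ => hr.1 i) (Finset.mem_univ i)
      _ = 1 := hr.2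
  have hcomp := isCompact_Icc.of_isClosed_subset hclosed hsub
  obtain ⟨π, hπ, hmin⟩ := hcomp.exists_isMinOn
    ⟨fun i j => r i * s j, fun i => by rw [← Finset.mul_sum, hs.2, mul_one],
      fun j => by rw [← Finset.sum_mul, hr.2, one_mul], fun i j => mul_nonneg (hr.1 i) (hs.1 j)⟩
    (f := fun π => ∑ i, ∑ j, c i j * π i j) (by fun_prop)
  exact ⟨π, hπ, fun π' hπ' => hmin hπ'⟩

theorem DualSummable.existsUnique_optimal {N : ℕ} {c : Fin N → Fin N → ℝ} (hc : DualSummable c)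
    {r s : Fin N → ℝ} (hr : r ∈ stdSimplex ℝ (Fin N)) (hs : s ∈ stdSimplex ℝ (Fin N)) :
    ∃! π, IsOptimalCouplingMatrix c r s π :=
  let ⟨π, hπ⟩ := exists_isOptimalCouplingMatrix c hr hs
  ⟨π, hπ, fun _ hπ' => hc.optimal_unique hπ' hπ⟩

/-! ### From coupling matrices to coupling measures -/

/-- If two points coincided, the 2-cycle with `i = j = ![a, b]` would have equal costs. Distinctness
of the atoms, needed to read weights off measures, thus comes from dual summability itself. -/
theorem DualSummable.injective_left {N : ℕ} {α β : Type*} {c : α → β → ℝ} {x : Fin N → α}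
    {y : Fin N → β} (h : DualSummable fun i j => c (x i) (y j)) : Function.Injective x := by
  intro a b hab
  by_contra hne
  have hinj : Function.Injective ![a, b] := by
    intro k l
    fin_cases k <;> fin_cases l <;> simp [hne, Ne.symm hne]
  refine h 2 le_rfl ![a, b] ![a, b] hinj hinj ?_
  rw [← Equiv.sum_comp (finRotate 2)]
  simp [Fin.sum_univ_two, hab, add_comm]

theorem DualSummable.injective_right {N : ℕ} {α β : Type*} {c : α → β → ℝ} {x : Fin N → α}
    {y : Fin N → β} (h : DualSummable fun i j => c (x i) (y j)) : Function.Injective y := by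
  intro a b hab
  by_contra hne
  have hinj : Function.Injective ![a, b] := by
    intro k l
    fin_cases k <;> fin_cases l <;> simp [hne, Ne.symm hne]
  refine h 2 le_rfl ![a, b] ![a, b] hinj hinj ?_
  refine Finset.sum_congr rfl fun k _ => ?_
  have hy : ∀ k, y (![a, b] k) = y b := by
    intro k
    fin_cases k <;> simp [hab]
  simp only [hy]

theorem weightedDirac_apply {N D : ℕ} (r : Fin N → ℝ) (x : Fin N → Fin D → ℝ)
    {S : Set (Fin D → ℝ)} (hS : MeasurableSet S) :
    weightedDirac r x S = ∑ k, ENNReal.ofReal (r k) * S.indicator 1 (x k) := by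
  simp [weightedDirac, Measure.dirac_apply' _ hS]

theorem weightedDirac_singleton {N D : ℕ} (r : Fin N → ℝ) {x : Fin N → Fin D → ℝ}
    (hx : Function.Injective x) (i : Fin N) :
    weightedDirac r x {x i} = ENNReal.ofReal (r i) := by
  rw [weightedDirac_apply r x (measurableSet_singleton _)]
  simp [Set.indicator_apply, hx.eq_iff]

theorem weightedDirac_compl_range {N D : ℕ} (r : Fin N → ℝ) (x : Fin N → Fin D → ℝ) :
    weightedDirac r x (Set.range x)ᶜ = 0 := by
  rw [weightedDirac_apply r x (Set.finite_range x).measurableSet.compl]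
  simp

instance isFiniteMeasure_weightedDirac {N D : ℕ} (r : Fin N → ℝ) (x : Fin N → Fin D → ℝ) :
    IsFiniteMeasure (weightedDirac r x) := by
  refine ⟨?_⟩
  rw [weightedDirac_apply r x MeasurableSet.univ]
  simp

theorem eq_of_weightedDirac_eq {N D : ℕ} {r r' : Fin N → ℝ} {x : Fin N → Fin D → ℝ}
    (hx : Function.Injective x) (hr : ∀ i, 0 ≤ r i) (hr' : ∀ i, 0 ≤ r' i)
    (h : weightedDirac r x = weightedDirac r' x) : r = r' := by
  funext i
  have := congrArg (fun m : Measure (Fin D → ℝ) => m {x i}) h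
  simp only [weightedDirac_singleton _ hx] at this
  exact (ENNReal.ofReal_eq_ofReal_iff (hr i) (hr' i)).1 this

/-- The discrete measure with mass `π i j` at `(x i, y j)`. -/
noncomputable def matrixMeasure {N D : ℕ} (x y : Fin N → Fin D → ℝ) (π : Fin N → Fin N → ℝ) :
    Measure ((Fin D → ℝ) × (Fin D → ℝ)) :=
  ∑ i, ∑ j, ENNReal.ofReal (π i j) • Measure.dirac (x i, y j)

theorem matrixMeasure_apply {N D : ℕ} (x y : Fin N → Fin D → ℝ) (π : Fin N → Fin N → ℝ)
    {S : Set ((Fin D → ℝ) × (Fin D → ℝ))} (hS : MeasurableSet S) :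
    matrixMeasure x y π S =
      ∑ i, ∑ j, ENNReal.ofReal (π i j) * S.indicator 1 (x i, y j) := by
  simp [matrixMeasure, Measure.dirac_apply' _ hS]

theorem fst_matrixMeasure {N D : ℕ} (x y : Fin N → Fin D → ℝ) {π : Fin N → Fin N → ℝ}
    (hπ : ∀ i j, 0 ≤ π i j) :
    (matrixMeasure x y π).fst = weightedDirac (fun i => ∑ j, π i j) x := by
  ext S hS
  rw [Measure.fst_apply hS, matrixMeasure_apply x y π (measurable_fst hS),
    weightedDirac_apply _ x hS]
  refine Finset.sum_congr rfl fun i _ => ?_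
  rw [ENNReal.ofReal_sum_of_nonneg fun j _ => hπ i j, Finset.sum_mul]
  rfl

theorem snd_matrixMeasure {N D : ℕ} (x y : Fin N → Fin D → ℝ) {π : Fin N → Fin N → ℝ}
    (hπ : ∀ i j, 0 ≤ π i j) :
    (matrixMeasure x y π).snd = weightedDirac (fun j => ∑ i, π i j) y := by
  ext S hS
  rw [Measure.snd_apply hS, matrixMeasure_apply x y π (measurable_snd hS),
    weightedDirac_apply _ y hS, Finset.sum_comm]
  refine Finset.sum_congr rfl fun j _ => ?_
  rw [ENNReal.ofReal_sum_of_nonneg fun i _ => hπ i j, Finset.sum_mul]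
  rfl

theorem lintegral_matrixMeasure {N D : ℕ} {c : (Fin D → ℝ) → (Fin D → ℝ) → ℝ}
    (hc : ∀ a b, 0 ≤ c a b) (x y : Fin N → Fin D → ℝ) {π : Fin N → Fin N → ℝ}
    (hπ : ∀ i j, 0 ≤ π i j) :
    ∫⁻ z, ENNReal.ofReal (c z.1 z.2) ∂(matrixMeasure x y π) =
      ENNReal.ofReal (∑ i, ∑ j, c (x i) (y j) * π i j) := by
  rw [ENNReal.ofReal_sum_of_nonneg fun i _ =>
    Finset.sum_nonneg fun j _ => mul_nonneg (hc _ _) (hπ i j)]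
  simp only [matrixMeasure, lintegral_finsetSum_measure, lintegral_smul_measure, lintegral_dirac,
    smul_eq_mul]
  refine Finset.sum_congr rfl fun i _ => ?_
  rw [ENNReal.ofReal_sum_of_nonneg fun j _ => mul_nonneg (hc _ _) (hπ i j)]
  refine Finset.sum_congr rfl fun j _ => ?_
  rw [ENNReal.ofReal_mul (hc _ _), mul_comm]

theorem IsCouplingMatrix.marginals {N D : ℕ} {r s : Fin N → ℝ} {π : Fin N → Fin N → ℝ}
    (h : IsCouplingMatrix r s π) (x y : Fin N → Fin D → ℝ) :
    (matrixMeasure x y π).fst = weightedDirac r x ∧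
      (matrixMeasure x y π).snd = weightedDirac s y := by
  rw [fst_matrixMeasure x y h.2.2, snd_matrixMeasure x y h.2.2, funext h.1, funext h.2.1]
  exact ⟨rfl, rfl⟩

/-- Every coupling of two finitely supported measures comes from a coupling matrix. -/
theorem exists_eq_matrixMeasure {N D : ℕ} {r s : Fin N → ℝ} (hr : ∀ i, 0 ≤ r i)
    (hs : ∀ i, 0 ≤ s i) {x y : Fin N → Fin D → ℝ} (hx : Function.Injective x)
    (hy : Function.Injective y) {γ : Measure ((Fin D → ℝ) × (Fin D → ℝ))}
    (h₁ : γ.fst = weightedDirac r x) (h₂ : γ.snd = weightedDirac s y) :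
    ∃ π, IsCouplingMatrix r s π ∧ γ = matrixMeasure x y π := by
  classical
  have hfin : IsFiniteMeasure γ := by
    refine ⟨?_⟩
    rw [← Measure.fst_univ, h₁]
    exact measure_lt_top _ _
  have hnull₁ : γ (Prod.fst ⁻¹' (Set.range x)ᶜ) = 0 := by
    rw [← Measure.fst_apply (Set.finite_range x).measurableSet.compl, h₁,
      weightedDirac_compl_range]
  have hnull₂ : γ (Prod.snd ⁻¹' (Set.range y)ᶜ) = 0 := by
    rw [← Measure.snd_apply (Set.finite_range y).measurableSet.compl, h₂,
      weightedDirac_compl_range]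
  set π : Fin N → Fin N → ℝ := fun i j => (γ {(x i, y j)}).toReal with hπdef
  have hπ : ∀ i j, 0 ≤ π i j := fun i j => ENNReal.toReal_nonneg
  have hγ : γ = matrixMeasure x y π := by
    ext S hS
    set T : Finset ((Fin D → ℝ) × (Fin D → ℝ)) :=
      Finset.univ.image fun a : Fin N × Fin N => (x a.1, y a.2) with hT
    -- Both marginals are concentrated on finite sets, so `γ` is concentrated on the grid `T` and is
    -- determined by its point masses.
    have h3 : γ S = γ ↑(T.filter (· ∈ S)) := by
      refine measure_congr ?_
      filter_upwards [measure_eq_zero_iff_ae_notMem.1 hnull₁,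
        measure_eq_zero_iff_ae_notMem.1 hnull₂] with z hz₁ hz₂
      simp only [Set.mem_preimage, Set.mem_compl_iff, not_not] at hz₁ hz₂
      obtain ⟨i, hi⟩ := hz₁
      obtain ⟨j, hj⟩ := hz₂
      have hzT : z ∈ T := Finset.mem_image.2 ⟨(i, j), Finset.mem_univ _, Prod.ext hi hj⟩
      refine propext ?_
      change z ∈ S ↔ z ∈ (↑(T.filter (· ∈ S)) : Set _)
      simp [hzT]
    rw [h3, ← sum_measure_singleton, Finset.sum_filter, hT, Finset.sum_image,
      matrixMeasure_apply x y π hS, Fintype.sum_prod_type]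
    · refine Finset.sum_congr rfl fun i _ => Finset.sum_congr rfl fun j _ => ?_
      rw [hπdef, ENNReal.ofReal_toReal (measure_ne_top _ _), Set.indicator_apply]
      simp
    · intro a _ b _ hab
      exact Prod.ext (hx (congrArg Prod.fst hab)) (hy (congrArg Prod.snd hab))
  refine ⟨π, ⟨fun i => ?_, fun j => ?_, hπ⟩, hγ⟩
  · rw [hγ, fst_matrixMeasure x y hπ] at h₁
    exact congrFun (eq_of_weightedDirac_eq hx
      (fun i => Finset.sum_nonneg fun j _ => hπ i j) hr h₁) i
  · rw [hγ, snd_matrixMeasure x y hπ] at h₂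
    exact congrFun (eq_of_weightedDirac_eq hy
      (fun j => Finset.sum_nonneg fun i _ => hπ i j) hs h₂) j

/-- Every competitor is a matrix measure, and for nonnegative costs `ENNReal.ofReal` both preserves
and reflects the order of total costs. -/
theorem isOptimalCouplingMeasure_matrixMeasure_iff {N D : ℕ} {c : (Fin D → ℝ) → (Fin D → ℝ) → ℝ}
    (hc : ∀ a b, 0 ≤ c a b) {r s : Fin N → ℝ} (hr : ∀ i, 0 ≤ r i) (hs : ∀ i, 0 ≤ s i)
    {x y : Fin N → Fin D → ℝ} (hx : Function.Injective x) (hy : Function.Injective y)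
    {π : Fin N → Fin N → ℝ} (hπ : IsCouplingMatrix r s π) :
    IsOptimalCouplingMeasure c (weightedDirac r x) (weightedDirac s y) (matrixMeasure x y π) ↔
      IsOptimalCouplingMatrix (fun i j => c (x i) (y j)) r s π := by
  have hcost : ∀ π', IsCouplingMatrix r s π' → 0 ≤ ∑ i, ∑ j, c (x i) (y j) * π' i j :=
    fun π' hπ' => Finset.sum_nonneg fun i _ => Finset.sum_nonneg fun j _ =>
      mul_nonneg (hc _ _) (hπ'.2.2 i j)
  constructor
  · rintro ⟨-, hopt⟩
    refine ⟨hπ, fun π' hπ' => ?_⟩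
    have h := hopt _ (hπ'.marginals x y)
    rw [lintegral_matrixMeasure hc x y hπ.2.2, lintegral_matrixMeasure hc x y hπ'.2.2] at h
    exact (ENNReal.ofReal_le_ofReal_iff (hcost π' hπ')).1 h
  · rintro ⟨-, hopt⟩
    refine ⟨hπ.marginals x y, fun γ' hγ' => ?_⟩
    obtain ⟨π', hπ', rfl⟩ := exists_eq_matrixMeasure hr hs hx hy hγ'.1 hγ'.2
    rw [lintegral_matrixMeasure hc x y hπ.2.2, lintegral_matrixMeasure hc x y hπ'.2.2]
    exact ENNReal.ofReal_le_ofReal (hopt π' hπ')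

theorem DualSummable.existsUnique_optimalMeasure {N D : ℕ}
    {c : (Fin D → ℝ) → (Fin D → ℝ) → ℝ} (hc : ∀ a b, 0 ≤ c a b) {x y : Fin N → Fin D → ℝ}
    (h : DualSummable fun i j => c (x i) (y j)) {r s : Fin N → ℝ}
    (hr : r ∈ stdSimplex ℝ (Fin N)) (hs : s ∈ stdSimplex ℝ (Fin N)) :
    ∃! γ, IsOptimalCouplingMeasure c (weightedDirac r x) (weightedDirac s y) γ := by
  have hx := h.injective_left
  have hy := h.injective_right
  obtain ⟨π, hπ, huniq⟩ := h.existsUnique_optimal hr hs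
  refine ⟨matrixMeasure x y π,
    (isOptimalCouplingMeasure_matrixMeasure_iff hc hr.1 hs.1 hx hy hπ.1).2 hπ, fun γ hγ => ?_⟩
  obtain ⟨π', hπ', rfl⟩ := exists_eq_matrixMeasure hr.1 hs.1 hx hy hγ.1.1 hγ.1.2
  rw [huniq π' ((isOptimalCouplingMeasure_matrixMeasure_iff hc hr.1 hs.1 hx hy hπ').1 hγ)]

theorem proposition6p5 {Ω : Type*} [MeasurableSpace Ω] (P : Measure Ω) [IsProbabilityMeasure P]
    (N D : ℕ) (hD : 2 ≤ D)
    (μ ν : Measure (Fin D → ℝ)) [IsProbabilityMeasure μ] [IsProbabilityMeasure ν]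
    (hμ : μ ≪ volume) (hν : ν ≪ volume)
    (X Y : Fin N → Ω → Fin D → ℝ)
    (hXlaw : ∀ k, HasLaw (X k) μ P) (hYlaw : ∀ k, HasLaw (Y k) ν P)
    (hX : iIndepFun X P) (hY : iIndepFun Y P)
    (hXY : IndepFun (fun ω k => X k ω) (fun ω k => Y k ω) P)
    (p q : ℝ) (hp : 0 < p) (hq : 0 < q) (hpq : ¬ (p = 1 ∧ q = 1)) :
    (∀ᵐ ω ∂P, DualSummable (fun i j => lqCost p q (X i ω) (Y j ω))) ∧
    (∀ᵐ ω ∂P, ∀ r ∈ stdSimplex ℝ (Fin N), ∀ s ∈ stdSimplex ℝ (Fin N),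
      (∃! π : Fin N → Fin N → ℝ,
        IsOptimalCouplingMatrix (fun i j => lqCost p q (X i ω) (Y j ω)) r s π) ∧
      (∃! γ : Measure ((Fin D → ℝ) × (Fin D → ℝ)),
        IsOptimalCouplingMeasure (lqCost p q)
          (weightedDirac r (fun k => X k ω)) (weightedDirac s (fun k => Y k ω)) γ)) := by
  obtain ⟨hmeas, hac⟩ := map_samples_absolutelyContinuous hμ hν hXlaw hYlaw hX hY hXY
  have h : ∀ᵐ ω ∂P, DualSummable (fun i j => lqCost p q (X i ω) (Y j ω)) :=
    ae_of_ae_map hmeas (hac.ae_le (ae_dualSummable_lqCost hD hp hq hpq))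
  refine ⟨h, ?_⟩
  -- Dual summability does not involve `r` and `s`, so one null set serves all weights at once.
  filter_upwards [h] with ω hω r hr s hs
  exact ⟨hω.existsUnique_optimal hr hs,
    hω.existsUnique_optimalMeasure (lqCost_nonneg p q) hr hs⟩
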